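/- Let $G$ be a finite simple graph with vertex set $V(G)$ that is triangle-free and has no isolated vertices, and let $d_v$ denote the degree of $v\in V(G)$. Write $K_{a,b}$ for the complete bipartite graph with parts of sizes $a$ and $b$. (1) Let $H$ be a finite graph, allowing loops, and for a finite simple graph $F$ let $\hom(F,H)$ be the number of graph homomorphisms from $F$ to $H$, that is, of maps $\varphi\colon V(F)\to V(H)$ such that $\varphi(u)\varphi(v)\in E(H)$ whenever $uv\in E(F)$. Then \[ \hom(G,H)\;\le\;\prod_{uv\in E(G)}\hom(K_{d_u,d_v},H)^{1/(d_ud_v)}. \] (2) The same inequality holds for weighted graphs $H$. That is, let $\Omega$ be a $\sigma$-finite measure space, let $H\colon\Omega\times\Omega\to\mathbb{R}_{\ge 0}$ be a symmetric measurable function, and for a finite simple graph $F$ put \[ \hom(F,H):=\int_{\Omega^{V(F)}}\ \prod_{uv\in E(F)}H(x_u,x_v)\ \prod_{v\in V(F)}dx_v\ \in[0,\infty]. \] Then \[ \hom(G,H)\;\le\;\prod_{uv\in E(G)}\hom(K_{d_u,d_v},H)^{1/(d_ud_v)} \] in $[0,\infty]$, with the conventions $0\cdot\infty=0$ and $\infty^{c}=\infty$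 for $c>0$. -/

import Mathlib

open MeasureTheory
open scoped NNReal ENNReal

universe u v w

/-- A graph allowing loops (without multiple edges) on the vertex set `W`. -/
structure LoopGraph (W : Type u) where
  Adj : W → W → Prop
  symm : ∀ x y, Adj x y → Adj y x

/-- A weighted graph: a symmetric measurable function `Ω × Ω → ℝ≥0` (the edge weights) on a
σ-finite measure space `Ω` (whose measure encodes the vertex weights). -/
structure WeightedGraph (Ω : Type u) [MeasurableSpace Ω] where
  vertexMeasure : Measure Ω
  sigmaFinite : SigmaFinite vertexMeasure
  weight : Ω → Ω → ℝ≥0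
  symm : ∀ x y, weight x y = weight y x
  measurable : Measurable (Function.uncurry weight)

attribute [instance] WeightedGraph.sigmaFinite

/-- The number of graph homomorphisms from `G` to `H`, that is, of maps `φ : V → W` such that
`φ a` and `φ b` are adjacent in `H` whenever `a` and `b` are adjacent in `G`. -/
noncomputable def LoopGraph.hom {V : Type v} {W : Type w} (G : SimpleGraph V)
    (H : LoopGraph W) : ℕ :=
  Nat.card (G.Adj →r H.Adj)

/-- The edge weight of a weighted graph as a function of unordered pairs. -/
def WeightedGraph.edgeWeight {Ω : Type u} [MeasurableSpace Ω] (H : WeightedGraph Ω) :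
    Sym2 Ω → ℝ≥0 :=
  Sym2.lift ⟨H.weight, H.symm⟩

/-- The weighted number of homomorphisms from `G` to `H`:
`∫_{Ω^V} ∏_{ab ∈ E(G)} H(x_a, x_b) ∏_{a ∈ V} dx_a`, with values in `[0, ∞]`. -/
noncomputable def WeightedGraph.hom {V : Type v} [Fintype V] {Ω : Type w} [MeasurableSpace Ω]
    (G : SimpleGraph V) [Fintype G.edgeSet] (H : WeightedGraph Ω) : ℝ≥0∞ :=
  ∫⁻ x : V → Ω, ∏ e ∈ G.edgeFinset, (H.edgeWeight (e.map x) : ℝ≥0∞)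
    ∂(Measure.pi fun _ : V => H.vertexMeasure)

/-- The complete bipartite graph `K_{a,b}`. -/
abbrev biclique (a b : ℕ) : SimpleGraph (Fin a ⊕ Fin b) :=
  completeBipartiteGraph (Fin a) (Fin b)

instance (a b : ℕ) : DecidableRel (biclique a b).Adj := fun p q =>
  inferInstanceAs (Decidable (p.isLeft ∧ q.isRight ∨ p.isRight ∧ q.isLeft))

def bicliqueSwap (a b : ℕ) : biclique a b ≃g biclique b a where
  toEquiv := Equiv.sumComm (Fin a) (Fin b)
  map_rel_iff' := by
    rintro (i | i) (j | j) <;> simp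

theorem LoopGraph.hom_biclique_comm {W : Type w} (H : LoopGraph W) (a b : ℕ) :
    H.hom (biclique a b) = H.hom (biclique b a) := by
  refine Nat.card_congr ⟨fun f => f.comp (bicliqueSwap b a).toRelEmbedding.toRelHom,
    fun f => f.comp (bicliqueSwap a b).toRelEmbedding.toRelHom, fun f => ?_, fun f => ?_⟩
  · ext (i | i) <;> rfl
  · ext (i | i) <;> rfl

theorem WeightedGraph.hom_congr {V : Type u} {V' : Type v} [Fintype V] [Fintype V'] {Ω : Type w}
    [MeasurableSpace Ω] {G : SimpleGraph V} {G' : SimpleGraph V'} [Fintype G.edgeSet]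
    [Fintype G'.edgeSet] (φ : G ≃g G') (H : WeightedGraph Ω) : H.hom G = H.hom G' := by
  have hmp := measurePreserving_piCongrLeft (fun _ : V' => H.vertexMeasure) φ.toEquiv
  unfold WeightedGraph.hom
  rw [← hmp.lintegral_comp_emb (MeasurableEquiv.measurableEmbedding _)]
  refine lintegral_congr fun x => ?_
  refine Finset.prod_bij (fun e _ => e.map φ) ?_ ?_ ?_ ?_
  · intro e he
    induction e with | _ p q => simpa [φ.map_adj_iff] using he
  · intro e _ e' _ h
    exact Sym2.map.injective φ.injective h
  · intro e he
    refine ⟨e.map φ.symm, ?_, ?_⟩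
    · induction e with | _ p q => simpa [φ.symm.map_adj_iff] using he
    · induction e with | _ p q => simp
  · intro e _
    induction e with | _ p q =>
    have key : ∀ r, MeasurableEquiv.piCongrLeft (fun _ : V' => Ω) φ.toEquiv x (φ r) = x r :=
      fun r => Equiv.piCongrLeft_apply_apply (fun _ : V' => Ω) φ.toEquiv x r
    simp [key]

/-- The factor `hom(K_{d_a, d_b}, H)^{1/(d_a d_b)}` attached to an edge `ab` of `G`. -/
noncomputable def LoopGraph.edgeFactor {V : Type v} [Fintype V] (G : SimpleGraph V)
    [DecidableRel G.Adj] {W : Type w} (H : LoopGraph W) : Sym2 V → ℝ :=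
  Sym2.lift ⟨fun a b => (H.hom (biclique (G.degree a) (G.degree b)) : ℝ) ^
      (1 / ((G.degree a : ℝ) * (G.degree b : ℝ))),
    fun a b => by
      beta_reduce
      rw [H.hom_biclique_comm, mul_comm (G.degree a : ℝ)]⟩

/-- The factor `hom(K_{d_a, d_b}, H)^{1/(d_a d_b)}` attached to an edge `ab` of `G`, for a
weighted graph `H`. -/
noncomputable def WeightedGraph.edgeFactor {V : Type v} [Fintype V] (G : SimpleGraph V)
    [DecidableRel G.Adj] {Ω : Type w} [MeasurableSpace Ω] (H : WeightedGraph Ω) :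
    Sym2 V → ℝ≥0∞ :=
  Sym2.lift ⟨fun a b => (H.hom (biclique (G.degree a) (G.degree b))) ^
      (1 / ((G.degree a : ℝ) * (G.degree b : ℝ))),
    fun a b => by
      beta_reduce
      rw [H.hom_congr (bicliqueSwap _ _), mul_comm (G.degree a : ℝ)]⟩

theorem lintegral_pi_fin_prod {Ω : Type*} [MeasurableSpace Ω] (μ : Measure Ω) [SigmaFinite μ]
    {n : ℕ} {f : Ω → ℝ≥0∞} (hf : Measurable f) :
    ∫⁻ x : Fin n → Ω, ∏ i, f (x i) ∂(Measure.pi fun _ => μ) = (∫⁻ y, f y ∂μ) ^ n := by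
  induction n with
  | zero => simp
  | succ n ih =>
    have hmp := (measurePreserving_piFinSuccAbove (fun _ : Fin (n + 1) => μ) 0).symm
    rw [← hmp.lintegral_comp_emb (MeasurableEquiv.measurableEmbedding _)]
    have : ∀ z : Ω × (Fin n → Ω), ∏ i, f ((MeasurableEquiv.piFinSuccAbove (fun _ => Ω) 0).symm z i)
        = f z.1 * ∏ i, f (z.2 i) := by
      intro z
      rw [Fin.prod_univ_succ]
      simp [MeasurableEquiv.piFinSuccAbove]
    simp_rw [this]
    rw [lintegral_prod_mul (g := fun x : Fin n → Ω => ∏ i, f (x i)) hf.aemeasurable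
      (Measurable.aemeasurable (by fun_prop)),
      ih, pow_succ']

/-- The weighted biclique integral
`∫_{Ω^a × Ω^b} ∏_i p(x_i) ∏_j q(y_j) ∏_{i,j} H(x_i, y_j)`, with the integral over `y` carried
out first. -/
noncomputable def bicliqueIntegral {Ω : Type*} [MeasurableSpace Ω] (μ : Measure Ω)
    (H : Ω → Ω → ℝ≥0∞) (a b : ℕ) (p q : Ω → ℝ≥0∞) : ℝ≥0∞ :=
  ∫⁻ x : Fin a → Ω, (∏ i, p (x i)) * (∫⁻ y, q y * ∏ i, H (x i) y ∂μ) ^ b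
    ∂(Measure.pi fun _ => μ)

section Biclique

variable {Ω : Type*} [MeasurableSpace Ω] {μ : Measure Ω} [SigmaFinite μ] {H : Ω → Ω → ℝ≥0∞}

theorem measurable_prod_kernel (hH : Measurable (Function.uncurry H)) (a : ℕ) :
    Measurable (fun z : (Fin a → Ω) × Ω => ∏ i, H (z.1 i) z.2) := by
  refine Finset.measurable_fun_prod _ fun i _ => ?_
  exact hH.comp (g := Function.uncurry H) (f := fun z : (Fin a → Ω) × Ω => (z.1 i, z.2))
    (by fun_prop)

theorem measurable_kernelIntegral (hH : Measurable (Function.uncurry H)) (a : ℕ)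
    {q : Ω → ℝ≥0∞} (hq : Measurable q) :
    Measurable (fun x : Fin a → Ω => ∫⁻ y, q y * ∏ i, H (x i) y ∂μ) := by
  have := measurable_prod_kernel hH a
  exact Measurable.lintegral_prod_right' (f := fun z : (Fin a → Ω) × Ω =>
    q z.2 * ∏ i, H (z.1 i) z.2) (by fun_prop)

theorem bicliqueIntegral_eq_double (hH : Measurable (Function.uncurry H)) (a b : ℕ)
    {p q : Ω → ℝ≥0∞} (hq : Measurable q) :
    bicliqueIntegral μ H a b p q = ∫⁻ x : Fin a → Ω, ∫⁻ y : Fin b → Ω,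
      (∏ i, p (x i)) * ((∏ j, q (y j)) * ∏ j, ∏ i, H (x i) (y j))
        ∂(Measure.pi fun _ => μ) ∂(Measure.pi fun _ => μ) := by
  unfold bicliqueIntegral
  refine lintegral_congr fun x => ?_
  have h1 : Measurable fun y => ∏ i, H (x i) y :=
    (measurable_prod_kernel hH a).comp (measurable_const.prodMk measurable_id)
  rw [lintegral_const_mul, ← lintegral_pi_fin_prod μ (by fun_prop)]
  · simp_rw [Finset.prod_mul_distrib]
  · simp_rw [← Finset.prod_mul_distrib]
    fun_prop

theorem bicliqueIntegral_comm (hH : Measurable (Function.uncurry H))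
    (hsymm : ∀ x y, H x y = H y x) (a b : ℕ)
    {p q : Ω → ℝ≥0∞} (hp : Measurable p) (hq : Measurable q) :
    bicliqueIntegral μ H a b p q = bicliqueIntegral μ H b a q p := by
  rw [bicliqueIntegral_eq_double hH a b hq, bicliqueIntegral_eq_double hH b a hp,
    lintegral_lintegral_swap]
  · refine lintegral_congr fun y => lintegral_congr fun x => ?_
    rw [Finset.prod_comm, mul_left_comm]
    simp_rw [hsymm]
  · refine Measurable.aemeasurable ?_
    have h : ∀ j i, Measurable fun z : (Fin a → Ω) × (Fin b → Ω) => H (z.1 i) (z.2 j) :=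
      fun j i => hH.comp (g := Function.uncurry H)
        (f := fun z : (Fin a → Ω) × (Fin b → Ω) => (z.1 i, z.2 j)) (by fun_prop)
    unfold Function.uncurry
    fun_prop

theorem exists_le_lintegral_lt_top {f : Ω → ℝ≥0∞} {L : ℝ≥0∞} (hL : L < ∫⁻ x, f x ∂μ) :
    ∃ g : Ω → ℝ≥0∞, Measurable g ∧ g ≤ f ∧ L < ∫⁻ x, g x ∂μ ∧ ∫⁻ x, g x ∂μ < ∞ := by
  rw [lintegral_eq_nnreal] at hL
  simp only [lt_iSup_iff] at hL
  obtain ⟨φ, hφ, hL⟩ := hL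
  rw [← SimpleFunc.lintegral_eq_lintegral] at hL
  obtain ⟨g, hg, hgt, hgL⟩ := SimpleFunc.exists_lt_lintegral_simpleFunc_of_lt_lintegral
    (μ := μ) (f := φ) (L := L) (by simpa using hL)
  exact ⟨fun x => g x, by fun_prop,
    fun x => (ENNReal.coe_le_coe.2 (hg x)).trans (hφ x), hgL, hgt⟩

end Biclique

section BicliqueHolder

variable {Ω : Type*} [MeasurableSpace Ω] {μ : Measure Ω} [SigmaFinite μ] {H : Ω → Ω → ℝ≥0∞}

theorem measurable_bicliqueIntegral_slice (hH : Measurable (Function.uncurry H)) (a b : ℕ)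
    {p q : Ω → ℝ≥0∞} (hp : Measurable p) (hq : Measurable q) :
    Measurable fun z => bicliqueIntegral μ H a b (fun x => p x * H x z) q := by
  have h1 := measurable_kernelIntegral (μ := μ) hH a hq
  have h2 : ∀ i, Measurable fun z : Ω × (Fin a → Ω) => H (z.2 i) z.1 := fun i =>
    hH.comp (g := Function.uncurry H) (f := fun z : Ω × (Fin a → Ω) => (z.2 i, z.1)) (by fun_prop)
  refine Measurable.lintegral_prod_right' (f := fun z : Ω × (Fin a → Ω) =>
    (∏ i, p (z.2 i) * H (z.2 i) z.1) * (∫⁻ y, q y * ∏ i, H (z.2 i) y ∂μ) ^ b) ?_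
  exact Measurable.mul (by fun_prop) ((h1.comp measurable_snd).pow_const b)

theorem lintegral_mul_bicliqueIntegral_slice_le (hH : Measurable (Function.uncurry H))
    (a c : ℕ) {p q φ : Ω → ℝ≥0∞} (hp : Measurable p) (hq : Measurable q) (hφ : Measurable φ) :
    ∫⁻ z, φ z * bicliqueIntegral μ H a c (fun x => p x * H x z) q ∂μ ≤
      bicliqueIntegral μ H a (c + 1) p q ^ ((c : ℝ) / (c + 1)) *
        bicliqueIntegral μ H a (c + 1) p φ ^ (1 / ((c : ℝ) + 1)) := by
  have hF := measurable_kernelIntegral (μ := μ) hH a hq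
  have hM := measurable_kernelIntegral (μ := μ) hH a hφ
  have hk := measurable_prod_kernel hH a
  have hc : (0 : ℝ) < (c : ℝ) + 1 := by positivity
  calc ∫⁻ z, φ z * bicliqueIntegral μ H a c (fun x => p x * H x z) q ∂μ
      = ∫⁻ z, ∫⁻ x : Fin a → Ω, φ z * ((∏ i, p (x i) * H (x i) z) *
          (∫⁻ y, q y * ∏ i, H (x i) y ∂μ) ^ c) ∂(Measure.pi fun _ => μ) ∂μ := by
        refine lintegral_congr fun z => ?_
        unfold bicliqueIntegral
        rw [lintegral_const_mul]
        have : ∀ i, Measurable fun x : Fin a → Ω => H (x i) z := fun i =>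
          hH.comp (g := Function.uncurry H) (f := fun x : Fin a → Ω => (x i, z)) (by fun_prop)
        fun_prop
    _ = ∫⁻ x : Fin a → Ω, ∫⁻ z, φ z * ((∏ i, p (x i) * H (x i) z) *
          (∫⁻ y, q y * ∏ i, H (x i) y ∂μ) ^ c) ∂μ ∂(Measure.pi fun _ => μ) := by
        refine lintegral_lintegral_swap (Measurable.aemeasurable ?_)
        have h2 : ∀ i, Measurable fun z : Ω × (Fin a → Ω) => H (z.2 i) z.1 := fun i =>
          hH.comp (g := Function.uncurry H) (f := fun z : Ω × (Fin a → Ω) => (z.2 i, z.1))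
            (by fun_prop)
        exact Measurable.mul (by fun_prop)
          (Measurable.mul (by fun_prop) ((hF.comp measurable_snd).pow_const c))
    _ = ∫⁻ x : Fin a → Ω, ((∏ i, p (x i)) * (∫⁻ y, q y * ∏ i, H (x i) y ∂μ) ^ c) *
          (∫⁻ z, φ z * ∏ i, H (x i) z ∂μ) ∂(Measure.pi fun _ => μ) := by
        refine lintegral_congr fun x => ?_
        rw [← lintegral_const_mul]
        · refine lintegral_congr fun z => ?_
          rw [Finset.prod_mul_distrib]
          ring
        · have : Measurable fun z => ∏ i, H (x i) z := hk.comp (measurable_const.prodMk measurable_id)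
          fun_prop
    _ = ∫⁻ x : Fin a → Ω,
          ((∏ i, p (x i)) * (∫⁻ y, q y * ∏ i, H (x i) y ∂μ) ^ (c + 1)) ^ ((c : ℝ) / (c + 1)) *
          ((∏ i, p (x i)) * (∫⁻ z, φ z * ∏ i, H (x i) z ∂μ) ^ (c + 1)) ^ (1 / ((c : ℝ) + 1))
          ∂(Measure.pi fun _ => μ) := by
        refine lintegral_congr fun x => ?_
        set P := ∏ i, p (x i)
        rw [ENNReal.mul_rpow_of_nonneg _ _ (by positivity),
          ENNReal.mul_rpow_of_nonneg _ _ (by positivity), mul_mul_mul_comm,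
          ← ENNReal.rpow_add_of_nonneg _ _ (by positivity) (by positivity),
          ← ENNReal.rpow_natCast, ← ENNReal.rpow_natCast _ (c + 1), ← ENNReal.rpow_natCast _ (c + 1),
          ← ENNReal.rpow_mul, ← ENNReal.rpow_mul]
        have e1 : (c : ℝ) / (c + 1) + 1 / (c + 1) = 1 := by field_simp
        have e2 : ((c + 1 : ℕ) : ℝ) * (c / (c + 1)) = c := by push_cast; field_simp
        have e3 : ((c + 1 : ℕ) : ℝ) * (1 / (c + 1)) = 1 := by push_cast; field_simp
        rw [e1, e2, e3, ENNReal.rpow_one, ENNReal.rpow_one, mul_assoc]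
    _ ≤ _ := by
        refine ENNReal.lintegral_mul_norm_pow_le ?_ ?_ (by positivity) (by positivity)
          (by field_simp)
        · exact Measurable.aemeasurable (by fun_prop)
        · exact Measurable.aemeasurable (by fun_prop)

theorem bicliqueIntegral_rpow_mul_rpow_le (hH : Measurable (Function.uncurry H))
    (a b d : ℕ) (ha : 0 < a) (had : a ≤ d)
    {p s ψ : Ω → ℝ≥0∞} (hp : Measurable p) (hs : Measurable s) (hψ : Measurable ψ) :
    bicliqueIntegral μ H b a
        (fun z => ψ z ^ (1 - (a : ℝ) / d) * s z ^ ((a : ℝ) / d)) p ≤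
      ((∫⁻ z, ψ z ∂μ) ^ b) ^ (1 - (a : ℝ) / d) *
        bicliqueIntegral μ H b d s p ^ ((a : ℝ) / d) := by
  have hd : (0 : ℝ) < d := by exact_mod_cast ha.trans_le had
  have h1 : 0 ≤ 1 - (a : ℝ) / d := by
    rw [sub_nonneg, div_le_one hd]; exact_mod_cast had
  have h2 : 0 ≤ (a : ℝ) / d := by positivity
  have hK := measurable_kernelIntegral (μ := μ) hH b hp
  rw [← lintegral_pi_fin_prod μ hψ]
  refine le_trans (le_of_eq ?_) (ENNReal.lintegral_mul_norm_pow_le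
    (Measurable.aemeasurable ?_) (Measurable.aemeasurable ?_) h1 h2 (by ring))
  · refine lintegral_congr fun x => ?_
    rw [ENNReal.mul_rpow_of_nonneg _ _ h2, Finset.prod_mul_distrib, mul_assoc,
      ENNReal.prod_rpow_of_nonneg h1, ENNReal.prod_rpow_of_nonneg h2,
      ← ENNReal.rpow_natCast _ d, ← ENNReal.rpow_mul, mul_div_cancel₀ _ hd.ne',
      ENNReal.rpow_natCast]
  · fun_prop
  · fun_prop

theorem lintegral_mul_bicliqueIntegral_slice_rpow_le (hH : Measurable (Function.uncurry H))
    (hsymm : ∀ x y, H x y = H y x)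
    (a c d : ℕ) (ha : 0 < a) (had : a ≤ d)
    {p q s : Ω → ℝ≥0∞} (hp : Measurable p) (hq : Measurable q) (hs : Measurable s) :
    ∫⁻ z, s z * bicliqueIntegral μ H a c (fun x => p x * H x z) q ^ ((d : ℝ) / a) ∂μ ≤
      (bicliqueIntegral μ H a (c + 1) p q ^ ((c : ℝ) / (c + 1))) ^ ((d : ℝ) / a) *
        bicliqueIntegral μ H d (c + 1) p s ^ (1 / ((c : ℝ) + 1)) := by
  have ha' : (0 : ℝ) < a := by exact_mod_cast ha
  have hd : (0 : ℝ) < d := by exact_mod_cast ha.trans_le had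
  have hc : (0 : ℝ) < (c : ℝ) + 1 := by positivity
  have h1 : 0 ≤ 1 - (a : ℝ) / d := by
    rw [sub_nonneg, div_le_one hd]; exact_mod_cast had
  have h2 : 0 < (a : ℝ) / d := by positivity
  refine le_of_forall_lt fun L hL => ?_
  obtain ⟨ψ, hψ, hle, hLψ, hlt⟩ := exists_le_lintegral_lt_top hL
  refine hLψ.trans_le ?_
  set A := ∫⁻ z, ψ z ∂μ with hA
  rcases eq_or_ne A 0 with h0 | h0
  · rw [h0]; exact zero_le
  set X := bicliqueIntegral μ H a (c + 1) p q ^ ((c : ℝ) / (c + 1))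
  set D := bicliqueIntegral μ H d (c + 1) p s with hD
  set φ : Ω → ℝ≥0∞ := fun z => ψ z ^ (1 - (a : ℝ) / d) * s z ^ ((a : ℝ) / d) with hφd
  have hφ : Measurable φ := by fun_prop
  have key1 : A ≤ ∫⁻ z, φ z * bicliqueIntegral μ H a c (fun x => p x * H x z) q ∂μ := by
    refine lintegral_mono fun z => ?_
    calc ψ z = ψ z ^ (1 - (a : ℝ) / d) * ψ z ^ ((a : ℝ) / d) := by
          rw [← ENNReal.rpow_add_of_nonneg _ _ h1 h2.le]; simp
      _ ≤ ψ z ^ (1 - (a : ℝ) / d) * (s z * bicliqueIntegral μ H a c (fun x => p x * H x z) q ^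
            ((d : ℝ) / a)) ^ ((a : ℝ) / d) := by
          gcongr; exact hle z
      _ = _ := by
          rw [ENNReal.mul_rpow_of_nonneg _ _ h2.le, ← ENNReal.rpow_mul,
            show (d : ℝ) / a * (a / d) = 1 by field_simp, ENNReal.rpow_one, mul_assoc]
  have key2 : A ≤ X * (((A ^ (c + 1)) ^ (1 - (a : ℝ) / d) * D ^ ((a : ℝ) / d))) ^
      (1 / ((c : ℝ) + 1)) := by
    refine key1.trans ((lintegral_mul_bicliqueIntegral_slice_le hH a c hp hq hφ).trans ?_)
    gcongr
    rw [bicliqueIntegral_comm hH hsymm a (c + 1) hp hφ, hD,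
      bicliqueIntegral_comm hH hsymm d (c + 1) hp hs]
    exact bicliqueIntegral_rpow_mul_rpow_le hH a (c + 1) d ha had hp hs hψ
  have key3 : A ^ (1 - (a : ℝ) / d) * A ^ ((a : ℝ) / d) ≤ A ^ (1 - (a : ℝ) / d) *
      (X * (D ^ (1 / ((c : ℝ) + 1))) ^ ((a : ℝ) / d)) := by
    rw [← ENNReal.rpow_add_of_nonneg _ _ h1 h2.le]
    refine le_trans (by simp) (key2.trans (le_of_eq ?_))
    rw [ENNReal.mul_rpow_of_nonneg _ _ (by positivity), ← ENNReal.rpow_natCast,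
      ← ENNReal.rpow_mul, ← ENNReal.rpow_mul, ← ENNReal.rpow_mul, ← ENNReal.rpow_mul,
      mul_comm ((a : ℝ) / d) (1 / ((c : ℝ) + 1)), mul_left_comm]
    congr 2
    push_cast
    field_simp
  have key4 : A ^ ((a : ℝ) / d) ≤ X * (D ^ (1 / ((c : ℝ) + 1))) ^ ((a : ℝ) / d) :=
    (ENNReal.mul_le_mul_iff_right (ENNReal.rpow_pos (pos_iff_ne_zero.2 h0) hlt.ne).ne'
      (ENNReal.rpow_ne_top_of_nonneg h1 hlt.ne)).1 key3
  calc A = (A ^ ((a : ℝ) / d)) ^ ((d : ℝ) / a) := by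
        rw [← ENNReal.rpow_mul, show (a : ℝ) / d * (d / a) = 1 by field_simp, ENNReal.rpow_one]
    _ ≤ (X * (D ^ (1 / ((c : ℝ) + 1))) ^ ((a : ℝ) / d)) ^ ((d : ℝ) / a) := by gcongr
    _ = _ := by
        rw [ENNReal.mul_rpow_of_nonneg _ _ (by positivity), ← ENNReal.rpow_mul _ ((a : ℝ) / d),
          show (a : ℝ) / d * (d / a) = 1 by field_simp, ENNReal.rpow_one]

end BicliqueHolder

section FiniteHolder

variable {Ω : Type*} [MeasurableSpace Ω] {μ : Measure Ω} {H : Ω → Ω → ℝ≥0∞}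

theorem lintegral_mul_prod_rpow_le {ι : Type*} (T : Finset ι) (hT : T.Nonempty) {s : Ω → ℝ≥0∞}
    (hs : Measurable s) {F : ι → Ω → ℝ≥0∞} (hF : ∀ i ∈ T, Measurable (F i)) :
    ∫⁻ z, s z * ∏ i ∈ T, F i z ^ (1 / (T.card : ℝ)) ∂μ ≤
      ∏ i ∈ T, (∫⁻ z, s z * F i z ∂μ) ^ (1 / (T.card : ℝ)) := by
  have hc : (0 : ℝ) < T.card := by exact_mod_cast hT.card_pos
  have key := ENNReal.lintegral_prod_norm_pow_le (μ := μ.withDensity s) T (f := F)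
    (fun i hi => (hF i hi).aemeasurable) (p := fun _ => 1 / (T.card : ℝ))
    (by simp [hc.ne']) (fun _ _ => by positivity)
  rw [lintegral_withDensity_eq_lintegral_mul _ hs
    (Finset.measurable_fun_prod _ fun i hi => (hF i hi).pow_const _)] at key
  refine key.trans_eq (Finset.prod_congr rfl fun i hi => ?_)
  rw [lintegral_withDensity_eq_lintegral_mul _ hs (hF i hi)]
  rfl

variable [SigmaFinite μ]

theorem bicliqueIntegral_one_zero {p q : Ω → ℝ≥0∞}
    (hp : Measurable p) : bicliqueIntegral μ H 1 0 p q = ∫⁻ x, p x ∂μ := by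
  unfold bicliqueIntegral
  simp only [pow_zero, mul_one]
  rw [lintegral_pi_fin_prod μ hp, pow_one]

theorem lintegral_star_le (hH : Measurable (Function.uncurry H)) (hsymm : ∀ x y, H x y = H y x)
    {ι : Type*} (T : Finset ι) (a : ι → ℕ) (d : ℕ) (hd : 0 < d)
    (ha : ∀ i ∈ T, 0 < a i) (had : ∀ i ∈ T, a i ≤ d) {p s : Ω → ℝ≥0∞} {q : ι → Ω → ℝ≥0∞}
    (hp : Measurable p) (hs : Measurable s) (hq : ∀ i, Measurable (q i)) :
    (∫⁻ z, s z * ((if T.card = 0 then ∫⁻ x, p x * H x z ∂μ else 1) *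
      ∏ i ∈ T, bicliqueIntegral μ H (a i) T.card (fun x => p x * H x z) (q i) ^
        (1 / ((T.card : ℝ) * a i))) ^ d ∂μ) ^ (1 / (d : ℝ)) ≤
    bicliqueIntegral μ H d (T.card + 1) p s ^ (1 / (((T.card + 1 : ℕ) : ℝ) * d)) *
      ∏ i ∈ T, bicliqueIntegral μ H (a i) (T.card + 1) p (q i) ^
        (1 / (((T.card + 1 : ℕ) : ℝ) * a i)) := by
  have hd' : (0 : ℝ) < d := by exact_mod_cast hd
  rcases T.eq_empty_or_nonempty with rfl | hT
  · have key := lintegral_mul_bicliqueIntegral_slice_rpow_le (μ := μ) hH hsymm 1 0 d one_pos hd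
      hp hp hs
    have e : ∀ z, bicliqueIntegral μ H 1 0 (fun x => p x * H x z) p = ∫⁻ x, p x * H x z ∂μ := by
      intro z
      refine bicliqueIntegral_one_zero (hp.mul ?_)
      exact hH.comp (g := Function.uncurry H) (f := fun x => (x, z)) (by fun_prop)
    simp only [e] at key
    simp only [Finset.card_empty, if_true, Finset.prod_empty, mul_one]
    calc _ ≤ (bicliqueIntegral μ H d (0 + 1) p s) ^ (1 / (d : ℝ)) := by
          gcongr
          simpa using key
      _ = _ := by simp
  have hT0 : T.card ≠ 0 := hT.card_pos.ne'
  have hc : (0 : ℝ) < T.card := by exact_mod_cast hT.card_pos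
  simp only [if_neg hT0, one_mul]
  calc (∫⁻ z, s z * (∏ i ∈ T, bicliqueIntegral μ H (a i) T.card (fun x => p x * H x z) (q i) ^
        (1 / ((T.card : ℝ) * a i))) ^ d ∂μ) ^ (1 / (d : ℝ))
      = (∫⁻ z, s z * ∏ i ∈ T, (bicliqueIntegral μ H (a i) T.card (fun x => p x * H x z) (q i) ^
        ((d : ℝ) / a i)) ^ (1 / (T.card : ℝ)) ∂μ) ^ (1 / (d : ℝ)) := by
        congr 1
        refine lintegral_congr fun z => ?_
        rw [← Finset.prod_pow]
        congr 1
        refine Finset.prod_congr rfl fun i hi => ?_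
        have : (0 : ℝ) < a i := by exact_mod_cast ha i hi
        rw [← ENNReal.rpow_natCast, ← ENNReal.rpow_mul, ← ENNReal.rpow_mul]
        congr 1
        field_simp
    _ ≤ (∏ i ∈ T, (∫⁻ z, s z * bicliqueIntegral μ H (a i) T.card (fun x => p x * H x z) (q i) ^
        ((d : ℝ) / a i) ∂μ) ^ (1 / (T.card : ℝ))) ^ (1 / (d : ℝ)) := by
        gcongr
        exact lintegral_mul_prod_rpow_le T hT hs fun i hi =>
          (measurable_bicliqueIntegral_slice hH _ _ hp (hq i)).pow_const _
    _ ≤ (∏ i ∈ T, ((bicliqueIntegral μ H (a i) (T.card + 1) p (q i) ^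
          ((T.card : ℝ) / (T.card + 1))) ^ ((d : ℝ) / a i) *
        bicliqueIntegral μ H d (T.card + 1) p s ^ (1 / ((T.card : ℝ) + 1))) ^
          (1 / (T.card : ℝ))) ^ (1 / (d : ℝ)) := by
        gcongr with i hi
        exact lintegral_mul_bicliqueIntegral_slice_rpow_le hH hsymm (a i) T.card d (ha i hi)
          (had i hi) hp (hq i) hs
    _ = ∏ i ∈ T, (bicliqueIntegral μ H (a i) (T.card + 1) p (q i) ^
          (1 / (((T.card + 1 : ℕ) : ℝ) * a i)) *
        (bicliqueIntegral μ H d (T.card + 1) p s ^ (1 / (((T.card + 1 : ℕ) : ℝ) * d))) ^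
          (1 / (T.card : ℝ))) := by
        rw [← ENNReal.prod_rpow_of_nonneg (by positivity)]
        refine Finset.prod_congr rfl fun i hi => ?_
        have : (0 : ℝ) < a i := by exact_mod_cast ha i hi
        rw [ENNReal.mul_rpow_of_nonneg _ _ (by positivity),
          ENNReal.mul_rpow_of_nonneg _ _ (by positivity)]
        simp only [← ENNReal.rpow_mul]
        congr 2
        · push_cast; field_simp
        · push_cast; field_simp
    _ = _ := by
        rw [Finset.prod_mul_distrib, Finset.prod_const, mul_comm, ← ENNReal.rpow_natCast,
          ← ENNReal.rpow_mul _ _ (T.card : ℝ), one_div_mul_cancel hc.ne', ENNReal.rpow_one]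

end FiniteHolder

section PairProducts

variable {V : Type*} (G : SimpleGraph V) [DecidableRel G.Adj]

/-- The number of neighbours of `v` in `S`. -/
def SimpleGraph.degreeIn (S : Finset V) (v : V) : ℕ := (S.filter (G.Adj v)).card

/-- The product of `P u v` over all adjacent ordered pairs in `S × T`. -/
def SimpleGraph.adjProd {M : Type*} [CommMonoid M] (S T : Finset V) (P : V → V → M) : M :=
  ∏ u ∈ S, ∏ v ∈ T, if G.Adj u v then P u v else 1

variable {G}

theorem SimpleGraph.adjProd_congr {M : Type*} [CommMonoid M] {S T : Finset V} {P Q : V → V → M}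
    (h : ∀ u ∈ S, ∀ v ∈ T, G.Adj u v → P u v = Q u v) : G.adjProd S T P = G.adjProd S T Q := by
  refine Finset.prod_congr rfl fun u hu => Finset.prod_congr rfl fun v hv => ?_
  split_ifs with huv
  · exact h u hu v hv huv
  · rfl

theorem SimpleGraph.adjProd_pow {M : Type*} [CommMonoid M] (S T : Finset V) (P : V → V → M)
    (n : ℕ) : G.adjProd S T P ^ n = G.adjProd S T fun u v => P u v ^ n := by
  unfold SimpleGraph.adjProd
  simp_rw [← Finset.prod_pow, ite_pow, one_pow]

theorem SimpleGraph.adjProd_swap {M : Type*} [CommMonoid M] {P : V → V → M}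
    (hP : ∀ u v, P u v = P v u) (S T : Finset V) : G.adjProd S T P = G.adjProd T S P := by
  unfold SimpleGraph.adjProd
  rw [Finset.prod_comm]
  simp_rw [G.adj_comm, hP]

variable [DecidableEq V]

theorem SimpleGraph.adjProd_union {M : Type*} [CommMonoid M] {P : V → V → M}
    (hP : ∀ u v, P u v = P v u) {S T : Finset V} (hST : Disjoint S T) :
    G.adjProd (S ∪ T) (S ∪ T) P = G.adjProd S S P * G.adjProd T S P ^ 2 * G.adjProd T T P := by
  have h := adjProd_swap (G := G) hP S T
  unfold SimpleGraph.adjProd at *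
  simp_rw [Finset.prod_union hST, Finset.prod_mul_distrib]
  rw [h, sq]
  simp only [mul_assoc]

theorem SimpleGraph.adjProd_erase {M : Type*} [CommMonoid M] {P : V → V → M}
    (hP : ∀ u v, P u v = P v u) {S : Finset V} {w : V} (hw : w ∈ S) :
    G.adjProd S S P = (∏ u ∈ (S.erase w).filter (G.Adj w), P u w ^ 2) *
      G.adjProd (S.erase w) (S.erase w) P := by
  have h : S = S.erase w ∪ {w} := by
    rw [Finset.union_singleton, Finset.insert_erase hw]
  conv_lhs => rw [h]
  rw [adjProd_union hP (by simp), mul_comm (_ * _ ^ 2), ← mul_assoc, mul_comm _ (_ ^ 2),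
    Finset.prod_filter]
  congr 1
  · simp only [adjProd, Finset.prod_singleton]
    rw [← Finset.prod_pow]
    refine Finset.prod_congr rfl fun u _ => ?_
    rw [ite_pow, one_pow, hP]
  · simp [adjProd]

theorem SimpleGraph.adjProd_split_neighbors {M : Type*} [CommMonoid M] {P : V → V → M}
    (hG : G.CliqueFree 3) (hP : ∀ u v, P u v = P v u) (S : Finset V) (w : V) :
    G.adjProd S S P =
      G.adjProd (S.filter fun u => ¬ G.Adj w u) (S.filter fun u => ¬ G.Adj w u) P *
      ∏ u ∈ S.filter (G.Adj w),
        ∏ v ∈ (S.filter fun u => ¬ G.Adj w u).filter (G.Adj u), P u v ^ 2 := by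
  have h := adjProd_union (G := G) hP
    (Finset.disjoint_filter_filter_not S S (G.Adj w)).symm
  rw [Finset.union_comm, Finset.filter_union_filter_not_eq] at h
  have h1 : G.adjProd (S.filter (G.Adj w)) (S.filter (G.Adj w)) P = 1 := by
    refine Finset.prod_eq_one fun u hu => Finset.prod_eq_one fun v hv => if_neg fun huv => ?_
    rw [Finset.mem_filter] at hu hv
    exact hG {w, u, v} (SimpleGraph.is3Clique_triple_iff.2 ⟨hu.2, hv.2, huv⟩)
  rw [h, h1, mul_one, adjProd_pow]
  congr 1
  exact Finset.prod_congr rfl fun u _ => (Finset.prod_filter _ _).symm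

theorem SimpleGraph.degreeIn_erase_of_adj {S : Finset V} {u w : V} (hw : w ∈ S)
    (h : G.Adj w u) : G.degreeIn S u = G.degreeIn (S.erase w) u + 1 := by
  unfold degreeIn
  rw [Finset.filter_erase, Finset.card_erase_add_one]
  exact Finset.mem_filter.2 ⟨hw, h.symm⟩

theorem SimpleGraph.degreeIn_erase_of_not_adj {S : Finset V} {u w : V}
    (h : ¬ G.Adj w u) : G.degreeIn (S.erase w) u = G.degreeIn S u := by
  unfold degreeIn
  rw [Finset.filter_erase, Finset.erase_eq_of_notMem]
  exact fun hm => h (Finset.mem_filter.1 hm).2.symm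

theorem SimpleGraph.card_filter_not_adj (hG : G.CliqueFree 3) (S : Finset V) {u w : V}
    (h : G.Adj w u) :
    ((S.filter fun v => ¬ G.Adj w v).filter (G.Adj u)).card = G.degreeIn S u := by
  unfold degreeIn
  congr 1
  rw [Finset.filter_filter]
  refine Finset.filter_congr fun v _ => ⟨fun hv => hv.2, fun hv => ⟨fun hwv => ?_, hv⟩⟩
  exact hG {w, u, v} (SimpleGraph.is3Clique_triple_iff.2 ⟨h, hwv, hv⟩)

end PairProducts

theorem ENNReal.rpow_half_sq (x : ℝ≥0∞) : (x ^ (1 / 2 : ℝ)) ^ 2 = x := by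
  rw [← ENNReal.rpow_natCast, ← ENNReal.rpow_mul]; norm_num

section MainInduction

variable {V : Type*} (G : SimpleGraph V) [DecidableRel G.Adj]
  {Ω : Type*} [MeasurableSpace Ω] (μ : Measure Ω) (H : Ω → Ω → ℝ≥0∞)

/-- The factor attached to the edge `uv` of the subgraph of `G` induced on `S`, where the copies of
`u` and `v` in the biclique have vertex weights `h u` and `h v`. -/
noncomputable def edgeBound (S : Finset V) (h : V → Ω → ℝ≥0∞) (u v : V) : ℝ≥0∞ :=
  bicliqueIntegral μ H (G.degreeIn S v) (G.degreeIn S u) (h u) (h v) ^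
    (1 / ((G.degreeIn S u : ℝ) * G.degreeIn S v))

/-- The factor attached to the vertex `v` in the subgraph of `G` induced on `S`: the total weight of
`v` if it is isolated. -/
noncomputable def isolatedFactor (S : Finset V) (h : V → Ω → ℝ≥0∞) (v : V) : ℝ≥0∞ :=
  if G.degreeIn S v = 0 then ∫⁻ x, h v x ∂μ else 1

/-- The vertex weights after pinning the vertex `w` at `z`. -/
noncomputable def pinWeights (w : V) (z : Ω) (h : V → Ω → ℝ≥0∞) (u : V) : Ω → ℝ≥0∞ :=
  if G.Adj w u then fun x => h u x * H x z else h u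

variable {G μ H}

theorem edgeBound_comm [SigmaFinite μ] (hH : Measurable (Function.uncurry H))
    (hsymm : ∀ x y, H x y = H y x) (S : Finset V) {h : V → Ω → ℝ≥0∞} (hh : ∀ v, Measurable (h v))
    (u v : V) : edgeBound G μ H S h u v = edgeBound G μ H S h v u := by
  unfold edgeBound
  rw [bicliqueIntegral_comm hH hsymm _ _ (hh u) (hh v), mul_comm (G.degreeIn S u : ℝ)]

theorem measurable_pinWeights (hH : Measurable (Function.uncurry H)) (w : V) (z : Ω)
    {h : V → Ω → ℝ≥0∞} (hh : ∀ v, Measurable (h v)) (u : V) :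
    Measurable (pinWeights G H w z h u) := by
  unfold pinWeights
  have : Measurable fun x => H x z :=
    hH.comp (g := Function.uncurry H) (f := fun x => (x, z)) (by fun_prop)
  have := hh u
  split_ifs <;> fun_prop

theorem measurable_prod_mul_adjProd {K : Ω → Ω → ℝ≥0∞} (hK : Measurable (Function.uncurry K))
    (S : Finset V) {h : V → Ω → ℝ≥0∞} (hh : ∀ v, Measurable (h v)) :
    Measurable fun x : V → Ω => (∏ v ∈ S, h v (x v)) * G.adjProd S S fun u v => K (x u) (x v) := by
  refine Measurable.mul (Finset.measurable_fun_prod _ fun v _ =>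
    (hh v).comp (measurable_pi_apply v)) (Finset.measurable_fun_prod _ fun u _ =>
      Finset.measurable_fun_prod _ fun v _ => Measurable.ite (by simp) ?_ measurable_const)
  exact hK.comp (g := Function.uncurry K) (f := fun x : V → Ω => (x u, x v)) (by fun_prop)

variable [DecidableEq V]

/-- The total contribution of a neighbour `u` of the pinned vertex to the bound for the remaining
graph, as a function of the position `z` of the pinned vertex. -/
noncomputable def neighborFactor (G : SimpleGraph V) [DecidableRel G.Adj] (μ : Measure Ω)
    (H : Ω → Ω → ℝ≥0∞) (S : Finset V) (h : V → Ω → ℝ≥0∞) (w u : V) (z : Ω) : ℝ≥0∞ :=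
  let T := ((S.erase w).filter fun v => ¬ G.Adj w v).filter (G.Adj u)
  (if T.card = 0 then ∫⁻ x, h u x * H x z ∂μ else 1) *
    ∏ v ∈ T, bicliqueIntegral μ H (G.degreeIn S v) T.card (fun x => h u x * H x z) (h v) ^
      (1 / ((T.card : ℝ) * G.degreeIn S v))

theorem measurable_neighborFactor [SigmaFinite μ] (hH : Measurable (Function.uncurry H))
    (S : Finset V) {h : V → Ω → ℝ≥0∞} (hh : ∀ v, Measurable (h v)) (w u : V) :
    Measurable (neighborFactor G μ H S h w u) := by
  refine Measurable.mul (Measurable.ite (by simp) ?_ measurable_const)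
    (Finset.measurable_fun_prod _ fun v _ =>
      (measurable_bicliqueIntegral_slice hH _ _ (hh u) (hh v)).pow_const _)
  have := hh u
  refine Measurable.lintegral_prod_right' (f := fun y : Ω × Ω => h u y.2 * H y.2 y.1) ?_
  have := hH.comp (g := Function.uncurry H) (f := fun y : Ω × Ω => (y.2, y.1)) (by fun_prop)
  exact Measurable.mul (by fun_prop) this

theorem pinned_bound_eq [SigmaFinite μ] (hG : G.CliqueFree 3)
    (hH : Measurable (Function.uncurry H))
    (hsymm : ∀ x y, H x y = H y x) {S : Finset V} {h : V → Ω → ℝ≥0∞} (hh : ∀ v, Measurable (h v))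
    (w : V) (z : Ω) :
    (∏ v ∈ S.erase w, isolatedFactor G μ (S.erase w) (pinWeights G H w z h) v) *
      G.adjProd (S.erase w) (S.erase w)
        (fun u v => edgeBound G μ H (S.erase w) (pinWeights G H w z h) u v ^ (1 / 2 : ℝ)) =
    (∏ v ∈ (S.erase w).filter fun v => ¬ G.Adj w v, isolatedFactor G μ S h v) *
      G.adjProd ((S.erase w).filter fun v => ¬ G.Adj w v)
        ((S.erase w).filter fun v => ¬ G.Adj w v)
        (fun u v => edgeBound G μ H S h u v ^ (1 / 2 : ℝ)) *
      ∏ u ∈ (S.erase w).filter (G.Adj w), neighborFactor G μ H S h w u z := by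
  rw [SimpleGraph.adjProd_split_neighbors hG (fun u v => by
    rw [edgeBound_comm hH hsymm _ (measurable_pinWeights hH w z hh)]) (S.erase w) w,
    ← Finset.prod_filter_mul_prod_filter_not (S.erase w) (G.Adj w)]
  have e1 : ∏ v ∈ (S.erase w).filter (fun v => ¬ G.Adj w v),
      isolatedFactor G μ (S.erase w) (pinWeights G H w z h) v =
      ∏ v ∈ (S.erase w).filter (fun v => ¬ G.Adj w v), isolatedFactor G μ S h v := by
    refine Finset.prod_congr rfl fun v hv => ?_
    have hv' := (Finset.mem_filter.1 hv).2
    simp only [isolatedFactor, pinWeights, if_neg hv', SimpleGraph.degreeIn_erase_of_not_adj hv']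
  have e2 : G.adjProd ((S.erase w).filter fun v => ¬ G.Adj w v)
        ((S.erase w).filter fun v => ¬ G.Adj w v)
        (fun u v => edgeBound G μ H (S.erase w) (pinWeights G H w z h) u v ^ (1 / 2 : ℝ)) =
      G.adjProd ((S.erase w).filter fun v => ¬ G.Adj w v)
        ((S.erase w).filter fun v => ¬ G.Adj w v)
        (fun u v => edgeBound G μ H S h u v ^ (1 / 2 : ℝ)) := by
    refine SimpleGraph.adjProd_congr fun u hu v hv _ => ?_
    have hu' := (Finset.mem_filter.1 hu).2
    have hv' := (Finset.mem_filter.1 hv).2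
    simp only [edgeBound, pinWeights, if_neg hv', if_neg hu',
      SimpleGraph.degreeIn_erase_of_not_adj hv', SimpleGraph.degreeIn_erase_of_not_adj hu']
  rw [e1, e2, mul_comm (∏ v ∈ (S.erase w).filter (G.Adj w), _), mul_mul_mul_comm,
    ← Finset.prod_mul_distrib]
  congr 1
  refine Finset.prod_congr rfl fun u hu => ?_
  have hu' := (Finset.mem_filter.1 hu).2
  unfold neighborFactor
  dsimp only
  rw [SimpleGraph.card_filter_not_adj hG _ hu']
  congr 1
  · simp only [isolatedFactor, pinWeights, if_pos hu']
  · refine Finset.prod_congr rfl fun v hv => ?_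
    have hv' := (Finset.mem_filter.1 (Finset.mem_filter.1 hv).1).2
    rw [ENNReal.rpow_half_sq]
    simp only [edgeBound, pinWeights, if_pos hu', if_neg hv',
      SimpleGraph.degreeIn_erase_of_not_adj hv']

theorem bound_eq [SigmaFinite μ] (hG : G.CliqueFree 3)
    (hH : Measurable (Function.uncurry H))
    (hsymm : ∀ x y, H x y = H y x) {S : Finset V} {h : V → Ω → ℝ≥0∞} (hh : ∀ v, Measurable (h v))
    {w : V} (hw : w ∈ S) :
    (∏ v ∈ S, isolatedFactor G μ S h v) *
      G.adjProd S S (fun u v => edgeBound G μ H S h u v ^ (1 / 2 : ℝ)) =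
    (∏ v ∈ (S.erase w).filter fun v => ¬ G.Adj w v, isolatedFactor G μ S h v) *
      G.adjProd ((S.erase w).filter fun v => ¬ G.Adj w v)
        ((S.erase w).filter fun v => ¬ G.Adj w v)
        (fun u v => edgeBound G μ H S h u v ^ (1 / 2 : ℝ)) *
      (isolatedFactor G μ S h w * ∏ u ∈ (S.erase w).filter (G.Adj w), (edgeBound G μ H S h u w *
        ∏ v ∈ ((S.erase w).filter fun v => ¬ G.Adj w v).filter (G.Adj u),
          edgeBound G μ H S h u v)) := by
  have hP : ∀ u v, edgeBound G μ H S h u v ^ (1 / 2 : ℝ) = edgeBound G μ H S h v u ^ (1 / 2 : ℝ) :=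
    fun u v => by rw [edgeBound_comm hH hsymm _ hh]
  rw [SimpleGraph.adjProd_erase hP hw, SimpleGraph.adjProd_split_neighbors hG hP (S.erase w) w,
    ← Finset.mul_prod_erase S _ hw, ← Finset.prod_filter_mul_prod_filter_not (S.erase w) (G.Adj w)]
  have e1 : ∏ v ∈ (S.erase w).filter (G.Adj w), isolatedFactor G μ S h v = 1 := by
    refine Finset.prod_eq_one fun v hv => ?_
    rw [isolatedFactor, if_neg]
    rw [SimpleGraph.degreeIn_erase_of_adj hw (Finset.mem_filter.1 hv).2]
    exact Nat.succ_ne_zero _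
  simp only [e1, one_mul, ENNReal.rpow_half_sq, Finset.prod_mul_distrib]
  ring

theorem lintegral_prod_neighborFactor_le [SigmaFinite μ] (hG : G.CliqueFree 3)
    (hH : Measurable (Function.uncurry H))
    (hsymm : ∀ x y, H x y = H y x) {S : Finset V} {h : V → Ω → ℝ≥0∞} (hh : ∀ v, Measurable (h v))
    {w : V} (hw : w ∈ S) (hmax : ∀ v ∈ S, G.degreeIn S v ≤ G.degreeIn S w) :
    ∫⁻ z, h w z * ∏ u ∈ (S.erase w).filter (G.Adj w), neighborFactor G μ H S h w u z ∂μ ≤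
      isolatedFactor G μ S h w * ∏ u ∈ (S.erase w).filter (G.Adj w), (edgeBound G μ H S h u w *
        ∏ v ∈ ((S.erase w).filter fun v => ¬ G.Adj w v).filter (G.Adj u),
          edgeBound G μ H S h u v) := by
  have hcard : ((S.erase w).filter (G.Adj w)).card = G.degreeIn S w :=
    SimpleGraph.degreeIn_erase_of_not_adj (G.loopless.irrefl w)
  rcases ((S.erase w).filter (G.Adj w)).eq_empty_or_nonempty with hN | hN
  · have h0 : G.degreeIn S w = 0 := by rw [← hcard, hN, Finset.card_empty]
    simp [hN, isolatedFactor, h0]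
  have hpos : 0 < G.degreeIn S w := by rw [← hcard]; exact hN.card_pos
  have hpos' : (0 : ℝ) < G.degreeIn S w := by exact_mod_cast hpos
  rw [isolatedFactor, if_neg hpos.ne', one_mul]
  have key := lintegral_mul_prod_rpow_le (μ := μ) _ hN (hh w)
    (F := fun u z => neighborFactor G μ H S h w u z ^ G.degreeIn S w)
    (fun u _ => (measurable_neighborFactor hH S hh w u).pow_const _)
  rw [hcard] at key
  have e : ∀ u z, (neighborFactor G μ H S h w u z ^ G.degreeIn S w) ^
      (1 / (G.degreeIn S w : ℝ)) = neighborFactor G μ H S h w u z := by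
    intro u z
    rw [← ENNReal.rpow_natCast, ← ENNReal.rpow_mul, mul_one_div_cancel hpos'.ne', ENNReal.rpow_one]
  simp only [e] at key
  refine key.trans (Finset.prod_le_prod' fun u hu => ?_)
  have hu' := Finset.mem_filter.1 hu
  have huS := Finset.mem_of_mem_erase hu'.1
  have hT := SimpleGraph.card_filter_not_adj hG (S.erase w) hu'.2
  have hdu := SimpleGraph.degreeIn_erase_of_adj hw hu'.2
  have star := lintegral_star_le (μ := μ) hH hsymm
    (((S.erase w).filter fun v => ¬ G.Adj w v).filter (G.Adj u)) (G.degreeIn S) (G.degreeIn S w)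
    hpos (fun v hv => ?_) (fun v hv => hmax v ?_) (hh u) (hh w) hh
  · refine star.trans (le_of_eq ?_)
    rw [hT, ← hdu]
    rfl
  · exact Finset.card_pos.2 ⟨u, Finset.mem_filter.2 ⟨huS, (Finset.mem_filter.1 hv).2.symm⟩⟩
  · exact Finset.mem_of_mem_erase (Finset.mem_filter.1 (Finset.mem_filter.1 hv).1).1

theorem lmarginal_const_mul {δ : Type*} [DecidableEq δ] {X : δ → Type*}
    [∀ i, MeasurableSpace (X i)] (ν : ∀ i, Measure (X i)) (s : Finset δ)
    {f : (∀ i, X i) → ℝ≥0∞} (hf : Measurable f) (c : ℝ≥0∞) (x : ∀ i, X i) :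
    (∫⋯∫⁻_s, (fun x => c * f x) ∂ν) x = c * (∫⋯∫⁻_s, f ∂ν) x := by
  unfold lmarginal
  exact lintegral_const_mul _ (hf.comp measurable_updateFinset)

theorem lmarginal_adjProd_le [SigmaFinite μ] (hG : G.CliqueFree 3) {K : Ω → Ω → ℝ≥0∞}
    (hK : Measurable (Function.uncurry K)) (hKsymm : ∀ x y, K x y = K y x)
    (hKH : ∀ x y, H x y = K x y ^ 2) (S : Finset V) {h : V → Ω → ℝ≥0∞}
    (hh : ∀ v, Measurable (h v)) (y : V → Ω) :
    (∫⋯∫⁻_S, (fun x => (∏ v ∈ S, h v (x v)) * G.adjProd S S fun u v => K (x u) (x v))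
      ∂(fun _ => μ)) y ≤
    (∏ v ∈ S, isolatedFactor G μ S h v) *
      G.adjProd S S (fun u v => edgeBound G μ H S h u v ^ (1 / 2 : ℝ)) := by
  have hH : Measurable (Function.uncurry H) := by
    have : Function.uncurry H = fun z => Function.uncurry K z ^ 2 := by
      ext z; exact hKH z.1 z.2
    rw [this]; fun_prop
  have hsymm : ∀ x y, H x y = H y x := fun x y => by rw [hKH, hKH, hKsymm]
  induction hn : S.card generalizing S h y with
  | zero =>
    rw [Finset.card_eq_zero] at hn
    subst hn
    simp [SimpleGraph.adjProd]
  | succ n ih =>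
    obtain ⟨w, hw, hmax⟩ := S.exists_max_image (G.degreeIn S)
      (Finset.card_pos.1 (hn ▸ Nat.succ_pos n))
    have hwS : w ∉ S.erase w := Finset.notMem_erase w S
    have hmeas := measurable_prod_mul_adjProd (G := G) hK S hh
    rw [lmarginal_erase _ hmeas hw, bound_eq hG hH hsymm hh hw]
    have hstep : ∀ z, (∫⋯∫⁻_(S.erase w), (fun x => (∏ v ∈ S, h v (x v)) *
        G.adjProd S S fun u v => K (x u) (x v)) ∂(fun _ => μ)) (Function.update y w z) =
        h w z * (∫⋯∫⁻_(S.erase w), (fun x =>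
          (∏ v ∈ S.erase w, pinWeights G H w z h v (x v)) *
          G.adjProd (S.erase w) (S.erase w) fun u v => K (x u) (x v)) ∂(fun _ => μ)) y := by
      intro z
      rw [lmarginal_update_of_notMem hmeas hwS, ← lmarginal_const_mul _ _
        (measurable_prod_mul_adjProd hK _ (measurable_pinWeights hH w z hh))]
      congr 1
      ext x
      rw [Function.comp_apply, ← Finset.mul_prod_erase S _ hw,
        SimpleGraph.adjProd_erase (fun u v => hKsymm _ _) hw, Function.update_self, mul_assoc,
        ← mul_assoc (∏ v ∈ S.erase w, _), Finset.prod_filter, ← Finset.prod_mul_distrib]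
      congr 2
      · refine Finset.prod_congr rfl fun v hv => ?_
        rw [Function.update_of_ne (Finset.ne_of_mem_erase hv)]
        unfold pinWeights
        split_ifs
        · rw [← hKH]
        · rw [mul_one]
      · refine SimpleGraph.adjProd_congr fun u hu v hv _ => ?_
        rw [Function.update_of_ne (Finset.ne_of_mem_erase hv),
          Function.update_of_ne (Finset.ne_of_mem_erase hu)]
    simp_rw [hstep]
    have hcard : (S.erase w).card = n := by rw [Finset.card_erase_of_mem hw, hn]; rfl
    calc _ ≤ ∫⁻ z, h w z * _ ∂μ := lintegral_mono fun z => mul_le_mul_right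
          (ih (S.erase w) (measurable_pinWeights hH w z hh) y hcard) _
      _ = _ * ∫⁻ z, h w z * ∏ u ∈ (S.erase w).filter (G.Adj w),
            neighborFactor G μ H S h w u z ∂μ := by
          rw [← lintegral_const_mul]
          · refine lintegral_congr fun z => ?_
            rw [pinned_bound_eq hG hH hsymm hh w z, mul_left_comm]
          · exact (hh w).mul (Finset.measurable_fun_prod _ fun u _ =>
              measurable_neighborFactor hH S hh w u)
      _ ≤ _ := mul_le_mul_right (lintegral_prod_neighborFactor_le hG hH hsymm hh hw hmax) _

end MainInduction

theorem prod_edgeFinset_eq_adjProd {V : Type*} [Fintype V] [DecidableEq V] (G : SimpleGraph V)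
    [DecidableRel G.Adj] (F : Sym2 V → ℝ≥0∞) :
    ∏ e ∈ G.edgeFinset, F e =
      G.adjProd Finset.univ Finset.univ fun u v => F s(u, v) ^ (1 / 2 : ℝ) := by
  unfold SimpleGraph.adjProd
  rw [← Finset.prod_product', ← Finset.prod_filter]
  rw [← Finset.prod_fiberwise_of_maps_to (t := G.edgeFinset) (g := fun p : V × V => s(p.1, p.2))
    (by simp)]
  refine Finset.prod_congr rfl fun e he => ?_
  induction e with | _ a b =>
  rw [SimpleGraph.mem_edgeFinset, SimpleGraph.mem_edgeSet] at he
  have hne : (a, b) ≠ (b, a) := fun h => he.ne (congrArg Prod.fst h)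
  have hfib : Finset.filter (fun p : V × V => s(p.1, p.2) = s(a, b))
      (Finset.filter (fun p : V × V => G.Adj p.1 p.2) (Finset.univ ×ˢ Finset.univ)) =
      {(a, b), (b, a)} := by
    ext ⟨c, d⟩
    simp only [Finset.mem_filter, Finset.mem_product, Finset.mem_univ, true_and, and_self,
      Sym2.eq_iff, Finset.mem_insert, Finset.mem_singleton, Prod.mk.injEq]
    refine ⟨fun h => h.2, fun h => ⟨?_, h⟩⟩
    rcases h with ⟨rfl, rfl⟩ | ⟨rfl, rfl⟩
    exacts [he, he.symm]
  rw [hfib, Finset.prod_pair hne]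
  dsimp only
  rw [Sym2.eq_swap (a := b), ← sq, ENNReal.rpow_half_sq]

theorem prod_edgeFinset_biclique {M : Type*} [CommMonoid M] (a b : ℕ)
    [Fintype (biclique a b).edgeSet] (F : Sym2 (Fin a ⊕ Fin b) → M) :
    ∏ e ∈ (biclique a b).edgeFinset, F e = ∏ i, ∏ j, F s(Sum.inl i, Sum.inr j) := by
  rw [← Finset.prod_product']
  symm
  refine Finset.prod_nbij (fun p : Fin a × Fin b => s(Sum.inl p.1, Sum.inr p.2)) ?_ ?_ ?_ ?_
  · intro p _
    simp
  · rintro ⟨i, j⟩ _ ⟨i', j'⟩ _ h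
    simpa using h
  · intro e he
    induction e with | _ p q =>
    simp only [SimpleGraph.coe_edgeFinset, SimpleGraph.mem_edgeSet] at he
    rcases p with i | i <;> rcases q with j | j
    · simp at he
    · exact ⟨(i, j), by simp, rfl⟩
    · exact ⟨(j, i), by simp, Sym2.eq_swap⟩
    · simp at he
  · intro p _
    rfl

namespace WeightedGraph

variable {Ω : Type w} [MeasurableSpace Ω] (H : WeightedGraph Ω)

theorem measurable_coe_weight :
    Measurable (Function.uncurry fun x y => (H.weight x y : ℝ≥0∞)) :=
  measurable_coe_nnreal_ennreal.comp H.measurable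

theorem hom_biclique (a b : ℕ) :
    H.hom (biclique a b) =
      bicliqueIntegral H.vertexMeasure (fun x y => (H.weight x y : ℝ≥0∞)) a b 1 1 := by
  rw [bicliqueIntegral_eq_double H.measurable_coe_weight a b measurable_one]
  unfold WeightedGraph.hom
  have hmp := measurePreserving_sumPiEquivProdPi_symm
    (fun _ : Fin a ⊕ Fin b => H.vertexMeasure)
  rw [← hmp.lintegral_comp_emb (MeasurableEquiv.measurableEmbedding _)]
  have e : ∀ z : (Fin a → Ω) × (Fin b → Ω), ∏ e ∈ (biclique a b).edgeFinset,
      (H.edgeWeight (e.map ((MeasurableEquiv.sumPiEquivProdPi fun _ => Ω).symm z)) : ℝ≥0∞) =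
      ∏ j, ∏ i, (H.weight (z.1 i) (z.2 j) : ℝ≥0∞) := by
    intro z
    rw [prod_edgeFinset_biclique, Finset.prod_comm]
    rfl
  simp_rw [e]
  rw [lintegral_prod]
  · simp
  · have h : ∀ j i, Measurable fun z : (Fin a → Ω) × (Fin b → Ω) =>
        (H.weight (z.1 i) (z.2 j) : ℝ≥0∞) :=
      fun j i => H.measurable_coe_weight.comp
        (f := fun z : (Fin a → Ω) × (Fin b → Ω) => (z.1 i, z.2 j)) (by fun_prop)
    exact Measurable.aemeasurable (by fun_prop)

theorem hom_le_prod_edgeFactor {V : Type v} [Fintype V] [DecidableEq V] (G : SimpleGraph V)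
    [DecidableRel G.Adj] (hG : G.CliqueFree 3) (hdeg : ∀ a : V, 0 < G.degree a) :
    H.hom G ≤ ∏ e ∈ G.edgeFinset, H.edgeFactor G e := by
  have hK : Measurable (Function.uncurry fun x y => (H.weight x y : ℝ≥0∞) ^ (1 / 2 : ℝ)) :=
    H.measurable_coe_weight.pow_const _
  have hd : ∀ v, G.degreeIn Finset.univ v = G.degree v := fun v => by
    rw [SimpleGraph.degreeIn, ← SimpleGraph.card_neighborFinset_eq_degree,
      SimpleGraph.neighborFinset_eq_filter]
  have hsymm : ∀ x y, (H.weight x y : ℝ≥0∞) = H.weight y x := fun x y => by rw [H.symm]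
  have hint : H.hom G = ∫⁻ x, (∏ v, (1 : V → Ω → ℝ≥0∞) v (x v)) *
      G.adjProd Finset.univ Finset.univ
        (fun u v => (H.weight (x u) (x v) : ℝ≥0∞) ^ (1 / 2 : ℝ))
        ∂(Measure.pi fun _ : V => H.vertexMeasure) := by
    refine lintegral_congr fun x => ?_
    rw [prod_edgeFinset_eq_adjProd G fun e => (H.edgeWeight (e.map x) : ℝ≥0∞)]
    simp only [Pi.one_apply, Finset.prod_const_one, one_mul]
    rfl
  rw [hint, prod_edgeFinset_eq_adjProd]
  rcases isEmpty_or_nonempty (V → Ω) with hE | ⟨⟨y⟩⟩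
  · rw [lintegral_of_isEmpty]
    exact zero_le
  rw [lintegral_eq_lmarginal_univ y]
  refine (lmarginal_adjProd_le hG hK (fun x y => by rw [hsymm])
    (fun x y => (ENNReal.rpow_half_sq (H.weight x y : ℝ≥0∞)).symm) Finset.univ
    (fun _ => measurable_one) y).trans (le_of_eq ?_)
  rw [Finset.prod_eq_one, one_mul]
  · refine SimpleGraph.adjProd_congr fun u _ v _ _ => ?_
    rw [edgeBound, hd, hd, bicliqueIntegral_comm H.measurable_coe_weight hsymm _ _ measurable_one
      measurable_one]
    simp only [WeightedGraph.edgeFactor, Sym2.lift_mk, hom_biclique]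
  · intro v _
    rw [isolatedFactor, hd, if_neg (hdeg v).ne']

end WeightedGraph

namespace LoopGraph

variable {W : Type w} [Finite W] (H : LoopGraph W)

open Classical in
/-- A graph with loops as a weighted graph with unit vertex weights and `0`-`1` edge weights. -/
noncomputable def toWeightedGraph [MeasurableSpace W] [DiscreteMeasurableSpace W] :
    WeightedGraph W where
  vertexMeasure := Measure.count
  sigmaFinite := inferInstance
  weight x y := if H.Adj x y then 1 else 0
  symm x y := by rw [propext ⟨H.symm x y, H.symm y x⟩]
  measurable := Measurable.of_discrete

theorem hom_toWeightedGraph [MeasurableSpace W] [DiscreteMeasurableSpace W]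
    {V : Type v} [Fintype V] (G : SimpleGraph V) [Fintype G.edgeSet] :
    H.toWeightedGraph.hom G = H.hom G := by
  classical
  have := Fintype.ofFinite W
  have hprod : ∀ x : V → W, ∏ e ∈ G.edgeFinset,
      (H.toWeightedGraph.edgeWeight (e.map x) : ℝ≥0∞) =
      if ∀ a b, G.Adj a b → H.Adj (x a) (x b) then 1 else 0 := by
    intro x
    split_ifs with h
    · refine Finset.prod_eq_one fun e he => ?_
      induction e with | _ a b =>
      have hab := h a b (by simpa using he)
      simp [WeightedGraph.edgeWeight, toWeightedGraph, hab]
    · push Not at h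
      obtain ⟨a, b, hab, hn⟩ := h
      refine Finset.prod_eq_zero (i := s(a, b)) (by simpa using hab) ?_
      simp [WeightedGraph.edgeWeight, toWeightedGraph, hn]
  have hμ : ∀ x : V → W, (Measure.pi fun _ : V => H.toWeightedGraph.vertexMeasure) {x} = 1 := by
    intro x
    rw [Measure.pi_singleton]
    exact Finset.prod_eq_one fun _ _ => Measure.count_singleton _
  unfold WeightedGraph.hom
  rw [lintegral_fintype]
  simp_rw [hprod, hμ, mul_one]
  rw [Finset.sum_boole, LoopGraph.hom, ← Fintype.card_subtype, ← Nat.card_eq_fintype_card]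
  congr 1
  exact Nat.card_congr ⟨fun x => ⟨x.1, fun {a b} h => x.2 a b h⟩, fun f => ⟨f, fun _ _ h => f.2 h⟩,
    fun _ => rfl, fun _ => rfl⟩

theorem hom_le_prod_edgeFactor {V : Type v} [Fintype V] [DecidableEq V] (G : SimpleGraph V)
    [DecidableRel G.Adj] (hG : G.CliqueFree 3) (hdeg : ∀ a : V, 0 < G.degree a) :
    (H.hom G : ℝ) ≤ ∏ e ∈ G.edgeFinset, H.edgeFactor G e := by
  let _ : MeasurableSpace W := ⊤
  have _ : DiscreteMeasurableSpace W := ⟨fun _ => trivial⟩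
  have key := H.toWeightedGraph.hom_le_prod_edgeFactor G hG hdeg
  have hfac : ∀ e, H.toWeightedGraph.edgeFactor G e = ENNReal.ofReal (H.edgeFactor G e) := by
    intro e
    induction e with | _ a b =>
    simp only [WeightedGraph.edgeFactor, LoopGraph.edgeFactor, Sym2.lift_mk, hom_toWeightedGraph]
    rw [← ENNReal.ofReal_rpow_of_nonneg (Nat.cast_nonneg _) (by positivity),
      ENNReal.ofReal_natCast]
  have hnn : ∀ e, 0 ≤ H.edgeFactor G e := by
    intro e
    induction e with | _ a b =>
    simp only [LoopGraph.edgeFactor, Sym2.lift_mk]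
    positivity
  simp only [hfac, hom_toWeightedGraph] at key
  rw [← ENNReal.ofReal_prod_of_nonneg fun e _ => hnn e, ← ENNReal.ofReal_natCast] at key
  exact (ENNReal.ofReal_le_ofReal_iff (Finset.prod_nonneg fun e _ => hnn e)).1 key

end LoopGraph

theorem mainTheorem2 {V : Type u} [Fintype V] [DecidableEq V] (G : SimpleGraph V)
    [DecidableRel G.Adj] (htriangle : G.CliqueFree 3) (hisolated : ∀ a : V, 0 < G.degree a) :
    (∀ (W : Type v) [Finite W] (H : LoopGraph W),
      (H.hom G : ℝ) ≤ ∏ e ∈ G.edgeFinset, H.edgeFactor G e) ∧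
    (∀ (Ω : Type w) [MeasurableSpace Ω] (H : WeightedGraph Ω),
      H.hom G ≤ ∏ e ∈ G.edgeFinset, H.edgeFactor G e) :=
  ⟨fun _ _ H => H.hom_le_prod_edgeFactor G htriangle hisolated,
    fun _ _ H => H.hom_le_prod_edgeFactor G htriangle hisolated⟩
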